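/- Let $\Bbbk$ be a field of characteristic $0$ and let $q\in\Bbbk$ be nonzero and not a root of unity. Let $A$ be an associative unital $\Bbbk$-algebra and let $X=(x_{ab})$ be an $n\times n$ $q$-generic matrix over $A$, i.e. its entries satisfy, for all $i<j$ and $k<l$ in $[n]=\{1,\dots,n\}$ (and all $a\in[n]$), $$x_{al}x_{ak}=q\,x_{ak}x_{al},\qquad x_{ja}x_{ia}=q\,x_{ia}x_{ja},\qquad x_{jk}x_{il}=x_{il}x_{jk},\qquad x_{jl}x_{ik}=x_{ik}x_{jl}+(q-q^{-1})\,x_{il}x_{jk}.$$ (For example, $X$ may be the matrix of generators of the algebra $\mathrm{M}_q(n)$ presented by these relations.) For $I=\{i_1<\dots<i_d\}\subseteq[n]$ let $$[I]=\sum_{\sigma\in\mathfrak S_d}(-q)^{-\ell(\sigma)}\,x_{i_{\sigma(1)},1}\,x_{i_{\sigma(2)},2}\cdots x_{i_{\sigma(d)},d}$$ be the quantum minor with row set $I$ and column set $\{1,\dots,d\}$, where $\ell(\sigma)$ is the number of inversions of $\sigma$ (so $[\emptyset]=1$). Let $I,J\subseteq[n]$ be such that $J$ surrounds $I$: $|J|\le|I|$,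 and $J\setminus I$ is a disjoint union $J'\sqcup J''$ of (possibly empty) sets such that $j'<i$ for all $j'\in J'$, $i\in I\setminus J$, and $i<j''$ for all $i\in I\setminus J$, $j''\in J''$. Then $[J]$ and $[I]$ $q$-commute: $$[J]\,[I]=q^{\,|J''|-|J'|}\,[I]\,[J].$$ -/

import Mathlib

/-- The entries of the `n × n` matrix `X` over the `k`-algebra `A` satisfy the relations that
make `X` a `q`-generic matrix. -/
structure IsQGeneric {k A : Type*} [Field k] [Ring A] [Algebra k A] {n : ℕ}
    (q : k) (X : Matrix (Fin n) (Fin n) A) : Prop where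
  row : ∀ i k l : Fin n, k < l → X i l * X i k = q • (X i k * X i l)
  col : ∀ i j k : Fin n, i < j → X j k * X i k = q • (X i k * X j k)
  anti : ∀ i j k l : Fin n, i < j → k < l → X j k * X i l = X i l * X j k
  diag : ∀ i j k l : Fin n, i < j → k < l →
    X j l * X i k = X i k * X j l + (q - q⁻¹) • (X i l * X j k)

/-- The length `ℓ(σ)` of a permutation: its number of inversions. -/
def permLength {d : ℕ} (σ : Equiv.Perm (Fin d)) : ℕ :=
  ((Finset.univ : Finset (Fin d × Fin d)).filter fun p => p.1 < p.2 ∧ σ p.2 < σ p.1).card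

/-- The quantum determinant
`∑ σ, (-q) ^ (-ℓ(σ)) a_{σ(1),1} a_{σ(2),2} ⋯ a_{σ(d),d}` (ordered products). -/
def qDet {k A : Type*} [Field k] [Ring A] [Algebra k A] {d : ℕ}
    (q : k) (M : Matrix (Fin d) (Fin d) A) : A :=
  ∑ σ : Equiv.Perm (Fin d),
    (-q) ^ (-(permLength σ : ℤ)) • (List.ofFn fun c : Fin d => M (σ c) c).prod

/-- The quantum minor `[I]` of `X`: the rows are the elements of `I` in increasing order, the
columns are the first `|I|` columns of `X`. -/
def qMinor {k A : Type*} [Field k] [Ring A] [Algebra k A] {n : ℕ}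
    (q : k) (X : Matrix (Fin n) (Fin n) A) (I : Finset (Fin n)) : A :=
  qDet q (X.submatrix (I.orderEmbOfFin rfl) (Fin.castLE (card_finset_fin_le I)))

/-- `J` surrounds `I`, with `J'`, `J''` as the two parts of `J \ I`. The set `J` surrounds `I`
if such a pair `J'`, `J''` exists. -/
structure Surrounds {n : ℕ} (J I J' J'' : Finset (Fin n)) : Prop where
  card_le : J.card ≤ I.card
  disj : Disjoint J' J''
  split : J \ I = J' ∪ J''
  left : ∀ j ∈ J', ∀ i ∈ I \ J, j < i
  right : ∀ i ∈ I \ J, ∀ j ∈ J'', i < j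

/-!
Write `[S | C]` for the quantum minor with rows `S` and columns `C`, and fix `D = [I | C]` with
`|I| = |C|`. The theorem is proved in the stronger form `[J | B] D = q ^ (|J''| - |J'|) D [J | B]`
for every `B ⊆ C` (`minor_mul_minor_of_surrounds`), by removing the elements of `J \ I` from `J` one
at a time.

Everything rests on two Laplace expansions, along an arbitrary row with the entries on the left
(`sum_entry_mul_minor`) and along an arbitrary column with the entries on the right
(`sum_minor_mul_entry`), each vanishing when a row or column is repeated. The column version holds
because the columns of `X` `q`-anticommute in the quantum exterior algebra (`colExp_swap`); the row
version follows by transposition (`minor_transpose`).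

Combining the expansions gives, for `c ∈ C`, that `x_{jc}` commutes with `D` if `j ∈ I`
(`entry_commute_minor`); and if `j ∉ I`, two relations expressing `x_{jc} D` and `D x_{jc}` through
the same products `[I - i + j | C] x_{ic}`. Eliminating either the products with `i > j` or those
with `i < j` between them,
  `x_{jc} D = q⁻¹ D x_{jc} + ∑_{i < j} P_i x_{ic}` and `x_{jc} D = q D x_{jc} + ∑_{i > j} P_i x_{ic}`
with coefficients `P_i` independent of `c`.

Now let `j ∈ J'`. All elements of `I` smaller than `j` lie in `J`, by the surrounding condition.
Expand `[J | B]` along row `j`, move `D` through the complementary minors, which have row set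
`J - j`, by induction, and then through `x_{jc}` by the first relation. The error terms assemble
into expansions of minors having a row `i ∈ J - j` twice, so they vanish, and a factor `q⁻¹` is
gained. For `j ∈ J''` the second relation yields a factor `q` in the same way. If `J ⊆ I`, every
entry occurring in `[J | B]` commutes with `D`.
-/

/-! ### Quantum minors by recursive column expansion -/

section ColumnExpansion

variable {k A : Type*} [Field k] [Ring A] [Algebra k A] {n : ℕ}

/-- For a list `c₁, …, c_d` of columns and a set `S` of rows, the coefficient of the ordered wedge
of the basis vectors in `S` in the product of the columns `∑ i, x_{i c₁} e_i`, …,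
`∑ i, x_{i c_d} e_i` in the quantum exterior algebra, written as an iterated expansion along the
first column of the list. The list may be unsorted or have repetitions; if its length is not `|S|`,
the value is `0`. -/
def colExp (q : k) (X : Matrix (Fin n) (Fin n) A) : List (Fin n) → Finset (Fin n) → A
  | [], S => if S = ∅ then 1 else 0
  | c :: cs, S => ∑ i ∈ S, (-q)⁻¹ ^ (S.filter (· < i)).card • (X i c * colExp q X cs (S.erase i))

theorem colExp_cons (q : k) (X : Matrix (Fin n) (Fin n) A) (c : Fin n) (cs : List (Fin n))
    (S : Finset (Fin n)) :
    colExp q X (c :: cs) S =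
      ∑ i ∈ S, (-q)⁻¹ ^ (S.filter (· < i)).card • (X i c * colExp q X cs (S.erase i)) := rfl

theorem card_filter_lt_erase {S : Finset (Fin n)} {i j : Fin n} (hi : i ∈ S) :
    (S.filter (· < j)).card = ((S.erase i).filter (· < j)).card + if i < j then 1 else 0 := by
  rw [Finset.filter_erase]
  split_ifs with h
  · rw [Finset.card_erase_add_one (by simp [hi, h])]
  · rw [Finset.erase_eq_of_notMem (by simp [h]), add_zero]

theorem card_filter_gt_erase {S : Finset (Fin n)} {i j : Fin n} (hi : i ∈ S) :
    (S.filter (j < ·)).card = ((S.erase i).filter (j < ·)).card + if j < i then 1 else 0 := by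
  rw [Finset.filter_erase]
  split_ifs with h
  · rw [Finset.card_erase_add_one (by simp [hi, h])]
  · rw [Finset.erase_eq_of_notMem (by simp [h]), add_zero]

theorem card_filter_lt_add_card_filter_gt {S : Finset (Fin n)} {i : Fin n} (hi : i ∈ S) :
    (S.filter (· < i)).card + (S.filter (i < ·)).card + 1 = S.card := by
  rw [← Finset.card_erase_add_one hi, ← Finset.card_union_of_disjoint]
  · congr 2
    ext a
    simp only [Finset.mem_union, Finset.mem_filter, Finset.mem_erase]
    grind
  · rw [Finset.disjoint_left]
    simp only [Finset.mem_filter]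
    grind

theorem sum_sum_erase_comm {M : Type*} [AddCommMonoid M] (S : Finset (Fin n))
    (f : Fin n → Fin n → M) :
    ∑ i ∈ S, ∑ j ∈ S.erase i, f i j = ∑ j ∈ S, ∑ i ∈ S.erase j, f i j :=
  Finset.sum_comm' fun i j => by simp only [Finset.mem_erase]; grind

theorem sum_sum_erase_eq_sum_lt {M : Type*} [AddCommMonoid M] (S : Finset (Fin n))
    (f : Fin n → Fin n → M) :
    ∑ i ∈ S, ∑ j ∈ S.erase i, f i j = ∑ i ∈ S, ∑ j ∈ S with i < j, (f i j + f j i) := by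
  have h : ∀ i ∈ S, ∑ j ∈ S.erase i, f i j =
      ∑ j ∈ S with i < j, f i j + ∑ j ∈ S with j < i, f i j := fun i _ => by
    rw [← Finset.sum_union]
    · congr 1
      ext a
      simp only [Finset.mem_union, Finset.mem_filter, Finset.mem_erase]
      grind
    · rw [Finset.disjoint_left]
      simp only [Finset.mem_filter]
      grind
  rw [Finset.sum_congr rfl h, Finset.sum_add_distrib]
  simp_rw [Finset.sum_add_distrib]
  congr 1
  exact Finset.sum_comm' fun i j => by simp only [Finset.mem_filter]; grind

/-- Expansion along two columns, the two orders of each pair of rows being grouped together: the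
inner factor is a `2 × 2` quantum determinant. -/
theorem colExp_cons_cons (q : k) (X : Matrix (Fin n) (Fin n) A) (c d : Fin n) (cs : List (Fin n))
    (S : Finset (Fin n)) :
    colExp q X (c :: d :: cs) S = ∑ i ∈ S, ∑ j ∈ S with i < j,
      (-q)⁻¹ ^ ((S.filter (· < i)).card + ((S.erase i).filter (· < j)).card) •
        ((X i c * X j d + (-q)⁻¹ • (X j c * X i d)) * colExp q X cs ((S.erase i).erase j)) := by
  simp only [colExp_cons, Finset.mul_sum, Finset.smul_sum]
  rw [sum_sum_erase_eq_sum_lt]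
  refine Finset.sum_congr rfl fun i hi => Finset.sum_congr rfl fun j hj => ?_
  obtain ⟨hj, hij⟩ := Finset.mem_filter.1 hj
  have e1 := card_filter_lt_erase (j := j) hi
  have e2 := card_filter_lt_erase (j := i) hj
  rw [if_pos hij] at e1
  rw [if_neg hij.not_gt] at e2
  rw [Finset.erase_right_comm (a := j), e1, e2]
  simp only [mul_smul_comm, smul_smul, ← pow_add, add_mul, smul_add, smul_mul_assoc, mul_assoc,
    ← pow_succ, add_zero]
  congr 3
  ring

/-- The two leading columns `q`-anticommute. The same holds in every position, since the columns in
front are only expanded along. -/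
theorem colExp_swap {q : k} (hq0 : q ≠ 0) {X : Matrix (Fin n) (Fin n) A} (hX : IsQGeneric q X)
    {c d : Fin n} (hcd : c < d) (cs : List (Fin n)) (S : Finset (Fin n)) :
    colExp q X (d :: c :: cs) S = (-q)⁻¹ • colExp q X (c :: d :: cs) S := by
  simp only [colExp_cons_cons, Finset.smul_sum]
  refine Finset.sum_congr rfl fun i hi => Finset.sum_congr rfl fun j hj => ?_
  obtain ⟨hj, hij⟩ := Finset.mem_filter.1 hj
  have e : X i d * X j c + (-q)⁻¹ • (X j d * X i c) =
      (-q)⁻¹ • (X i c * X j d + (-q)⁻¹ • (X j c * X i d)) := by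
    rw [hX.diag i j c d hij hcd, hX.anti i j c d hij hcd]
    match_scalars <;> field_simp
    ring
  rw [e, smul_mul_assoc, smul_comm]

theorem colExp_repeat {q : k} (hq0 : q ≠ 0) {X : Matrix (Fin n) (Fin n) A} (hX : IsQGeneric q X)
    (c : Fin n) (cs : List (Fin n)) (S : Finset (Fin n)) :
    colExp q X (c :: c :: cs) S = 0 := by
  rw [colExp_cons_cons]
  refine Finset.sum_eq_zero fun i hi => Finset.sum_eq_zero fun j hj => ?_
  obtain ⟨hj, hij⟩ := Finset.mem_filter.1 hj
  rw [hX.col i j c hij]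
  have : X i c * X j c + (-q)⁻¹ • q • (X i c * X j c) = 0 := by
    match_scalars
    field_simp
    ring
  rw [this, zero_mul, smul_zero]

/-- Expansion along the last column of the list, with the entries on the right. -/
theorem colExp_concat (q : k) (X : Matrix (Fin n) (Fin n) A) (cs : List (Fin n)) (c : Fin n)
    (S : Finset (Fin n)) :
    colExp q X (cs ++ [c]) S =
      ∑ i ∈ S, (-q)⁻¹ ^ (S.filter (i < ·)).card • (colExp q X cs (S.erase i) * X i c) := by
  induction cs generalizing S with
  | nil =>
    rw [List.nil_append, colExp_cons]
    refine Finset.sum_congr rfl fun i hi => ?_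
    by_cases h : S.erase i = ∅
    · have := (Finset.erase_eq_empty_iff S i).1 h
      obtain rfl : S = {i} := this.resolve_left (by rintro rfl; simp at hi)
      simp [colExp, Finset.filter_singleton]
    · simp [colExp, h]
  | cons b cs ih =>
    simp only [List.cons_append, colExp_cons, ih, Finset.mul_sum, Finset.smul_sum, Finset.sum_mul]
    rw [sum_sum_erase_comm]
    refine Finset.sum_congr rfl fun i hi => Finset.sum_congr rfl fun j hj => ?_
    obtain ⟨hji, hj⟩ := Finset.mem_erase.1 hj
    have e1 := card_filter_lt_erase (j := j) hi
    have e2 := card_filter_gt_erase (j := i) hj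
    rw [Finset.erase_right_comm (a := j), e1, e2]
    simp only [mul_smul_comm, smul_smul, ← pow_add, smul_mul_assoc, mul_assoc]
    congr 2
    split_ifs <;> ring

/-- The quantum minor `[S | C]` of `X` with row set `S` and column set `C`; it is `0` if
`|S| ≠ |C|`. -/
def minor (q : k) (X : Matrix (Fin n) (Fin n) A) (S C : Finset (Fin n)) : A :=
  colExp q X C.sort S

theorem sort_insert_min {C : Finset (Fin n)} {a : Fin n} (h : ∀ b ∈ C, a < b) :
    (insert a C).sort = a :: C.sort :=
  Finset.sort_insert _ (fun b hb => (h b hb).le) fun ha => (h a ha).false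

theorem minor_insert_min (q : k) (X : Matrix (Fin n) (Fin n) A) (S : Finset (Fin n))
    {C : Finset (Fin n)} {a : Fin n} (h : ∀ b ∈ C, a < b) :
    minor q X S (insert a C) =
      ∑ i ∈ S, (-q)⁻¹ ^ (S.filter (· < i)).card • (X i a * minor q X (S.erase i) C) := by
  rw [minor, sort_insert_min h, colExp_cons]
  rfl

/-- A column put in front of a sorted list can be moved to its place; if it already occurs in the
list, it meets its copy and the result vanishes. -/
theorem colExp_cons_sort {q : k} (hq0 : q ≠ 0) {X : Matrix (Fin n) (Fin n) A}
    (hX : IsQGeneric q X) (c : Fin n) (C S : Finset (Fin n)) :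
    colExp q X (c :: C.sort) S =
      if c ∈ C then 0 else (-q)⁻¹ ^ (C.filter (· < c)).card • minor q X S (insert c C) := by
  induction C using Finset.induction_on_min generalizing S with
  | empty => simp [minor]
  | insert a C h ih =>
    have ha : a ∉ C := fun ha => (h a ha).false
    rw [sort_insert_min h]
    rcases lt_trichotomy c a with hc | rfl | hc
    · have hc' : ∀ b ∈ insert a C, c < b := by
        intro b hb
        rcases Finset.mem_insert.1 hb with rfl | hb
        exacts [hc, hc.trans (h b hb)]
      rw [if_neg fun hh => (hc' c hh).false, Finset.filter_false_of_mem fun b hb => (hc' b hb).not_gt,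
        Finset.card_empty, pow_zero, one_smul, minor, sort_insert_min hc', sort_insert_min h]
    · rw [colExp_repeat hq0 hX, if_pos (Finset.mem_insert_self _ _)]
    · rw [colExp_swap hq0 hX hc, colExp_cons]
      simp only [ih, Finset.mem_insert, hc.ne', false_or]
      split_ifs with hcC
      · simp
      · have hc' : ∀ b ∈ insert c C, a < b := by
          intro b hb
          rcases Finset.mem_insert.1 hb with rfl | hb
          exacts [hc, h b hb]
        rw [Finset.insert_comm, minor_insert_min q X S hc', Finset.filter_insert, if_pos hc,
          Finset.card_insert_of_notMem (by simp [ha]), pow_succ', mul_smul, Finset.smul_sum,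
          Finset.smul_sum, Finset.smul_sum]
        refine Finset.sum_congr rfl fun i _ => ?_
        rw [mul_smul_comm, smul_comm (_ ^ _) (_ ^ _) (_ : A)]

/-- The analogue of `colExp_cons_sort` for a column appended at the end. -/
theorem colExp_sort_concat {q : k} (hq0 : q ≠ 0) {X : Matrix (Fin n) (Fin n) A}
    (hX : IsQGeneric q X) (c : Fin n) (C S : Finset (Fin n)) :
    colExp q X (C.sort ++ [c]) S =
      if c ∈ C then 0 else (-q)⁻¹ ^ (C.filter (c < ·)).card • minor q X S (insert c C) := by
  induction C using Finset.induction_on_min generalizing S with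
  | empty => simp [minor]
  | insert a C h ih =>
    have ha : a ∉ C := fun ha => (h a ha).false
    rw [sort_insert_min h, List.cons_append, colExp_cons]
    rcases lt_or_ge a c with hc | hc
    · simp only [ih, Finset.mem_insert, hc.ne', false_or]
      split_ifs with hcC
      · simp
      · have hc' : ∀ b ∈ insert c C, a < b := by
          intro b hb
          rcases Finset.mem_insert.1 hb with rfl | hb
          exacts [hc, h b hb]
        rw [Finset.insert_comm, minor_insert_min q X S hc', Finset.filter_insert,
          if_neg hc.not_gt, Finset.smul_sum]
        refine Finset.sum_congr rfl fun i _ => ?_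
        rw [mul_smul_comm, smul_comm (_ ^ _) (_ ^ _) (_ : A)]
    · -- Here `c` precedes all of `C`, so it can be moved to the front of the tail.
      have hcC : ∀ b ∈ C, c < b := fun b hb => hc.trans_lt (h b hb)
      have e : ∀ T, colExp q X (C.sort ++ [c]) T =
          (-q)⁻¹ ^ C.card • colExp q X (c :: C.sort) T := fun T => by
        rw [ih, if_neg fun hh => (hcC c hh).false, Finset.filter_true_of_mem hcC, minor,
          sort_insert_min hcC]
      have e' : ∑ i ∈ S, (-q)⁻¹ ^ (S.filter (· < i)).card •
            (X i a * colExp q X (C.sort ++ [c]) (S.erase i)) =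
          (-q)⁻¹ ^ C.card • colExp q X (a :: c :: C.sort) S := by
        rw [colExp_cons q X a, Finset.smul_sum]
        refine Finset.sum_congr rfl fun i _ => ?_
        rw [e, mul_smul_comm, smul_comm (_ ^ _) (_ ^ _) (_ : A)]
      rw [e']
      rcases hc.eq_or_lt with rfl | hc
      · rw [colExp_repeat hq0 hX, smul_zero, if_pos (Finset.mem_insert_self _ _)]
      · have hc' : ∀ b ∈ insert a C, c < b := by
          intro b hb
          rcases Finset.mem_insert.1 hb with rfl | hb
          exacts [hc, hcC b hb]
        rw [colExp_swap hq0 hX hc, if_neg fun hh => (hc' c hh).false,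
          Finset.filter_true_of_mem hc', Finset.card_insert_of_notMem ha, minor,
          sort_insert_min hc', sort_insert_min h, pow_succ, mul_smul]

end ColumnExpansion

/-! ### Transposition -/

section Transpose

variable {k A : Type*} [Field k] [Ring A] [Algebra k A] {n : ℕ}

theorem IsQGeneric.transpose {q : k} {X : Matrix (Fin n) (Fin n) A} (hX : IsQGeneric q X) :
    IsQGeneric q X.transpose where
  row i c d h := hX.col c d i h
  col i j c h := hX.row c i j h
  anti i j c d hij hcd := (hX.anti c d i j hcd hij).symm
  diag i j c d hij hcd := by
    simp only [Matrix.transpose_apply]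
    rw [hX.diag c d i j hcd hij, hX.anti c d i j hcd hij]

theorem minor_empty_left (q : k) (X : Matrix (Fin n) (Fin n) A) (C : Finset (Fin n)) :
    minor q X ∅ C = if C = ∅ then 1 else 0 := by
  induction C using Finset.induction_on_min with
  | empty => simp [minor, colExp]
  | insert a C h _ => rw [minor_insert_min q X ∅ h]; simp

/-- Expansion of a quantum minor along its first row. -/
theorem minor_insert_min_left {q : k} {X : Matrix (Fin n) (Fin n) A} (hX : IsQGeneric q X)
    {r : Fin n} {S : Finset (Fin n)} (hr : ∀ i ∈ S, r < i) (C : Finset (Fin n)) :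
    minor q X (insert r S) C =
      ∑ c ∈ C, (-q)⁻¹ ^ (C.filter (· < c)).card • (X r c * minor q X S (C.erase c)) := by
  have hrS : r ∉ S := fun h => (hr r h).false
  induction C using Finset.induction_on_min generalizing S with
  | empty => simp [minor, colExp]
  | insert a C h ih =>
    have ha : a ∉ C := fun ha => (h a ha).false
    have eC : ∀ c ∈ C, ((insert a C).filter (· < c)).card = (C.filter (· < c)).card + 1 :=
      fun c hc => by
        rw [Finset.filter_insert, if_pos (h c hc), Finset.card_insert_of_notMem (by simp [ha])]
    have eS : ∀ i ∈ S, ((insert r S).filter (· < i)).card = (S.filter (· < i)).card + 1 :=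
      fun i hi => by
        rw [Finset.filter_insert, if_pos (hr i hi), Finset.card_insert_of_notMem (by simp [hrS])]
    have er : ((insert r S).filter (· < r)) = ∅ := by
      refine Finset.filter_false_of_mem fun b hb => ?_
      rcases Finset.mem_insert.1 hb with rfl | hb
      exacts [lt_irrefl _, (hr b hb).not_gt]
    have ea : ((insert a C).filter (· < a)) = ∅ := by
      refine Finset.filter_false_of_mem fun b hb => ?_
      rcases Finset.mem_insert.1 hb with rfl | hb
      exacts [lt_irrefl _, (h b hb).not_gt]
    rw [minor_insert_min q X _ h, Finset.sum_insert hrS, Finset.sum_insert ha, er, ea,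
      Finset.erase_insert hrS, Finset.erase_insert ha]
    congr 1
    -- An entry of a lower row in column `a` commutes with the entries of row `r` right of `a`, so
    -- the expansions along column `a` and along row `r` can be interchanged.
    have e1 : ∀ i ∈ S, (-q)⁻¹ ^ ((insert r S).filter (· < i)).card •
          (X i a * minor q X ((insert r S).erase i) C) =
        ∑ c ∈ C, (-q)⁻¹ ^ ((S.filter (· < i)).card + 1 + (C.filter (· < c)).card) •
          (X r c * X i a * minor q X (S.erase i) (C.erase c)) := fun i hi => by
      rw [eS i hi, Finset.erase_insert_of_ne (hr i hi).ne,
        ih (fun b hb => hr b (Finset.mem_of_mem_erase hb))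
          (fun hh => hrS (Finset.mem_of_mem_erase hh)), Finset.mul_sum, Finset.smul_sum]
      refine Finset.sum_congr rfl fun c hc => ?_
      rw [mul_smul_comm, smul_smul, ← pow_add, ← mul_assoc, hX.anti r i a c (hr i hi) (h c hc)]
    rw [Finset.sum_congr rfl e1, Finset.sum_comm]
    refine Finset.sum_congr rfl fun c hc => ?_
    rw [eC c hc, Finset.erase_insert_of_ne (h c hc).ne,
      minor_insert_min q X _ fun b hb => h b (Finset.mem_of_mem_erase hb), Finset.mul_sum,
      Finset.smul_sum]
    refine Finset.sum_congr rfl fun i hi => ?_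
    rw [mul_smul_comm, smul_smul, ← pow_add, mul_assoc]
    congr 2
    ring

/-- Quantum minors are invariant under transposition. -/
theorem minor_transpose {q : k} {X : Matrix (Fin n) (Fin n) A} (hX : IsQGeneric q X)
    (S C : Finset (Fin n)) : minor q X.transpose C S = minor q X S C := by
  induction S using Finset.induction_on_min generalizing C with
  | empty => rw [minor_empty_left]; simp [minor, colExp]
  | insert r S h ih =>
    rw [minor_insert_min_left hX h, minor_insert_min q X.transpose C h]
    simp only [ih, Matrix.transpose_apply]

/-- Laplace expansion along an arbitrary row, with the entries on the left. -/
theorem sum_entry_mul_minor {q : k} (hq0 : q ≠ 0) {X : Matrix (Fin n) (Fin n) A}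
    (hX : IsQGeneric q X) (j : Fin n) (S C : Finset (Fin n)) :
    ∑ c ∈ C, (-q)⁻¹ ^ (C.filter (· < c)).card • (X j c * minor q X S (C.erase c)) =
      if j ∈ S then 0 else (-q)⁻¹ ^ (S.filter (· < j)).card • minor q X (insert j S) C := by
  have h := colExp_cons_sort hq0 hX.transpose j S C
  rw [minor_transpose hX, colExp_cons] at h
  rw [← h]
  refine Finset.sum_congr rfl fun c _ => ?_
  rw [← minor_transpose hX]
  rfl

/-- Laplace expansion along an arbitrary column, with the entries on the right. -/
theorem sum_minor_mul_entry {q : k} (hq0 : q ≠ 0) {X : Matrix (Fin n) (Fin n) A}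
    (hX : IsQGeneric q X) (c : Fin n) (S C : Finset (Fin n)) :
    ∑ i ∈ S, (-q)⁻¹ ^ (S.filter (i < ·)).card • (minor q X (S.erase i) C * X i c) =
      if c ∈ C then 0 else (-q)⁻¹ ^ (C.filter (c < ·)).card • minor q X S (insert c C) := by
  rw [← colExp_sort_concat hq0 hX, colExp_concat]
  rfl

end Transpose

/-! ### Commuting an entry past a quantum minor -/

section Entry

variable {k A : Type*} [Field k] [Ring A] [Algebra k A] {n : ℕ}

/-- The double sum of `x_{jd} [I - i | C - d] x_{ic}` over `d ∈ C` and `i ∈ I`, suitably weighted,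
evaluated in two ways: summing over `i` leaves only `d = c` and gives `x_{jc} [I | C]`; summing
over `d` gives the minors in which row `i` is replaced by row `j`. -/
theorem entry_mul_minor_eq_sum {q : k} (hq0 : q ≠ 0) {X : Matrix (Fin n) (Fin n) A}
    (hX : IsQGeneric q X) {I C : Finset (Fin n)} (j : Fin n) {c : Fin n} (hc : c ∈ C) :
    (-q)⁻¹ ^ (C.card - 1) • (X j c * minor q X I C) =
      ∑ i ∈ I, (-q)⁻¹ ^ (I.filter (i < ·)).card • ((if j ∈ I.erase i then 0 else
        (-q)⁻¹ ^ ((I.erase i).filter (· < j)).card • minor q X (insert j (I.erase i)) C) *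
          X i c) := by
  have h1 : ∀ d ∈ C, ∑ i ∈ I, (-q)⁻¹ ^ (I.filter (i < ·)).card •
      (minor q X (I.erase i) (C.erase d) * X i c) =
      if d = c then (-q)⁻¹ ^ (C.filter (c < ·)).card • minor q X I C else 0 := fun d hd => by
    rw [sum_minor_mul_entry hq0 hX]
    by_cases hdc : d = c
    · subst hdc
      rw [if_neg (by simp), if_pos rfl, Finset.insert_erase hc, Finset.filter_erase,
        Finset.erase_eq_of_notMem (by simp)]
    · rw [if_neg hdc, if_pos (by simp [hc, Ne.symm hdc])]
  simp_rw [← sum_entry_mul_minor hq0 hX j _ C, Finset.sum_mul, Finset.smul_sum]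
  rw [Finset.sum_comm]
  have h2 : ∀ d ∈ C, ∑ i ∈ I, (-q)⁻¹ ^ (I.filter (i < ·)).card •
      ((-q)⁻¹ ^ (C.filter (· < d)).card • (X j d * minor q X (I.erase i) (C.erase d)) * X i c) =
      if d = c then (-q)⁻¹ ^ (C.card - 1) • (X j c * minor q X I C) else 0 := fun d hd => by
    have := congrArg (fun y => (-q)⁻¹ ^ (C.filter (· < d)).card • (X j d * y)) (h1 d hd)
    simp only [Finset.mul_sum, Finset.smul_sum] at this
    refine Eq.trans (Finset.sum_congr rfl fun i _ => ?_) (this.trans ?_)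
    · rw [smul_mul_assoc, mul_smul_comm, smul_comm, mul_assoc]
    · split_ifs with hdc
      · subst hdc
        rw [mul_smul_comm, smul_smul, ← pow_add, ← card_filter_lt_add_card_filter_gt hd,
          Nat.add_sub_cancel]
      · simp
  rw [Finset.sum_congr rfl h2, Finset.sum_ite_eq' C c, if_pos hc]

/-- A full-size quantum minor is central among the entries of its own submatrix. -/
theorem entry_commute_minor {q : k} (hq0 : q ≠ 0) {X : Matrix (Fin n) (Fin n) A}
    (hX : IsQGeneric q X) {I C : Finset (Fin n)} (hIC : I.card = C.card) {j c : Fin n}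
    (hj : j ∈ I) (hc : c ∈ C) : Commute (X j c) (minor q X I C) := by
  have h := entry_mul_minor_eq_sum hq0 hX (I := I) j hc
  rw [Finset.sum_eq_single_of_mem j hj fun i _ hij => by simp [hij.symm, hj],
    if_neg (by simp), Finset.insert_erase hj, Finset.filter_erase,
    Finset.erase_eq_of_notMem (by simp), smul_mul_assoc, smul_smul, ← pow_add, ← hIC,
    ← card_filter_lt_add_card_filter_gt hj, Nat.add_sub_cancel, add_comm] at h
  have hw : (-q)⁻¹ ≠ 0 := inv_ne_zero (neg_ne_zero.2 hq0)
  exact (IsUnit.mk0 _ (pow_ne_zero _ hw)).smul_left_cancel.1 h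

/-- The expansion of a minor with rows `I + j` and the column `c` repeated, solved for the term of
row `j`. Up to the factors `-1` and `(-q)⁻²` the terms are those of `entry_mul_minor_eq_sum`. -/
theorem minor_mul_entry_eq_sum {q : k} (hq0 : q ≠ 0) {X : Matrix (Fin n) (Fin n) A}
    (hX : IsQGeneric q X) {I C : Finset (Fin n)} {j c : Fin n} (hj : j ∉ I) (hc : c ∈ C) :
    (-q)⁻¹ ^ I.card • (minor q X I C * X j c) =
      -∑ i ∈ I, (if i < j then (-q)⁻¹ ^ 2 else 1) •
        (-q)⁻¹ ^ ((I.filter (i < ·)).card + ((I.erase i).filter (· < j)).card) •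
          (minor q X (insert j (I.erase i)) C * X i c) := by
  have h := sum_minor_mul_entry hq0 hX c (insert j I) C
  rw [if_pos hc, Finset.sum_insert hj, Finset.erase_insert hj] at h
  have h' := congrArg (fun y => (-q)⁻¹ ^ (I.filter (· < j)).card • y) (eq_neg_of_add_eq_zero_left h)
  simp only [smul_neg, Finset.smul_sum, smul_smul, ← pow_add] at h' ⊢
  have ej : (I.filter (· < j)).card + ((insert j I).filter (j < ·)).card = I.card := by
    have := card_filter_lt_add_card_filter_gt (Finset.mem_insert_self j I)
    rw [Finset.card_insert_of_notMem hj, Finset.filter_insert, if_neg (lt_irrefl j)] at this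
    omega
  rw [ej] at h'
  rw [h', neg_inj]
  refine Finset.sum_congr rfl fun i hi => ?_
  have hij : i ≠ j := fun e => hj (e ▸ hi)
  rw [Finset.erase_insert_of_ne hij.symm, card_filter_lt_erase (j := j) hi, Finset.filter_insert]
  congr 1
  split_ifs with h1
  · rw [Finset.card_insert_of_notMem (by simp [hj])]
    ring
  · ring

end Entry

/-! ### `q`-commutation of quantum minors -/

section QCommute

variable {k A : Type*} [Field k] [Ring A] [Algebra k A] {n : ℕ}

/-- An entry outside the rows of `[I | C]` commutes with it up to the factor `q⁻¹` and error terms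
from rows above it. The coefficients `P` do not depend on the column. -/
theorem exists_entry_mul_minor_eq_inv_smul {q : k} (hq0 : q ≠ 0) {X : Matrix (Fin n) (Fin n) A}
    (hX : IsQGeneric q X) {I C : Finset (Fin n)} (hIC : I.card = C.card) {j : Fin n}
    (hj : j ∉ I) : ∃ P : Fin n → A, (∀ i ∈ I, ¬ i < j → P i = 0) ∧ ∀ c ∈ C,
      X j c * minor q X I C = q⁻¹ • (minor q X I C * X j c) + ∑ i ∈ I, P i * X i c := by
  have hw : (-q)⁻¹ ≠ 0 := inv_ne_zero (neg_ne_zero.2 hq0)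
  refine ⟨fun i => ((((-q)⁻¹ ^ (C.card - 1))⁻¹ * (1 - if i < j then (-q)⁻¹ ^ 2 else 1)) *
    (-q)⁻¹ ^ ((I.filter (i < ·)).card + ((I.erase i).filter (· < j)).card)) •
      minor q X (insert j (I.erase i)) C, fun i _ hij => by simp [hij], fun c hc => ?_⟩
  have h1 := entry_mul_minor_eq_sum hq0 hX (I := I) j hc
  have h2 := minor_mul_entry_eq_sum hq0 hX hj hc
  simp only [Finset.mem_erase, hj, and_false, if_false, smul_mul_assoc, smul_smul, ← pow_add]
    at h1
  have hd : I.card = C.card - 1 + 1 := by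
    have := Finset.card_pos.2 ⟨c, hc⟩
    omega
  rw [hd, pow_succ, mul_smul] at h2
  refine (IsUnit.mk0 _ (pow_ne_zero (C.card - 1) hw)).smul_left_cancel.1 ?_
  have h3 : (-q)⁻¹ ^ (C.card - 1) • q⁻¹ • (minor q X I C * X j c) =
      -((-q)⁻¹ ^ (C.card - 1) • (-q)⁻¹ • (minor q X I C * X j c)) := by
    rw [inv_neg, neg_smul, smul_neg, neg_neg]
  rw [h1, smul_add, h3, h2, neg_neg, Finset.smul_sum, ← Finset.sum_add_distrib]
  refine Finset.sum_congr rfl fun i _ => ?_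
  rw [smul_mul_assoc, smul_smul, smul_smul, ← add_smul]
  congr 1
  have hu := mul_inv_cancel₀ (pow_ne_zero (C.card - 1) hw)
  generalize ((-q)⁻¹ ^ (C.card - 1))⁻¹ = u at hu ⊢
  generalize (if i < j then (-q)⁻¹ ^ 2 else 1) = t
  linear_combination -((1 - t) *
    (-q)⁻¹ ^ ((I.filter (i < ·)).card + ((I.erase i).filter (· < j)).card)) * hu

/-- The counterpart of `exists_entry_mul_minor_eq_inv_smul` with factor `q` and error terms from
rows below the entry. -/
theorem exists_entry_mul_minor_eq_smul {q : k} (hq0 : q ≠ 0) {X : Matrix (Fin n) (Fin n) A}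
    (hX : IsQGeneric q X) {I C : Finset (Fin n)} (hIC : I.card = C.card) {j : Fin n}
    (hj : j ∉ I) : ∃ P : Fin n → A, (∀ i ∈ I, i < j → P i = 0) ∧ ∀ c ∈ C,
      X j c * minor q X I C = q • (minor q X I C * X j c) + ∑ i ∈ I, P i * X i c := by
  have hw : (-q)⁻¹ ≠ 0 := inv_ne_zero (neg_ne_zero.2 hq0)
  refine ⟨fun i => ((((-q)⁻¹ ^ (C.card - 1))⁻¹ * (1 - q ^ 2 * if i < j then (-q)⁻¹ ^ 2 else 1)) *
    (-q)⁻¹ ^ ((I.filter (i < ·)).card + ((I.erase i).filter (· < j)).card)) •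
      minor q X (insert j (I.erase i)) C, fun i _ hij => by simp [hij, hq0], fun c hc => ?_⟩
  have h1 := entry_mul_minor_eq_sum hq0 hX (I := I) j hc
  have h2 := minor_mul_entry_eq_sum hq0 hX hj hc
  simp only [Finset.mem_erase, hj, and_false, if_false, smul_mul_assoc, smul_smul, ← pow_add]
    at h1
  have hd : I.card = C.card - 1 + 1 := by
    have := Finset.card_pos.2 ⟨c, hc⟩
    omega
  rw [hd, pow_succ] at h2
  refine (IsUnit.mk0 _ (pow_ne_zero (C.card - 1) hw)).smul_left_cancel.1 ?_
  have h3 : (-q)⁻¹ ^ (C.card - 1) • q • (minor q X I C * X j c) =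
      -(q ^ 2 • ((-q)⁻¹ ^ (C.card - 1) * (-q)⁻¹) • (minor q X I C * X j c)) := by
    rw [smul_smul, smul_smul, ← neg_smul]
    congr 1
    field_simp
  rw [h1, smul_add, h3, h2, smul_neg, neg_neg, Finset.smul_sum, Finset.smul_sum,
    ← Finset.sum_add_distrib]
  refine Finset.sum_congr rfl fun i _ => ?_
  rw [smul_mul_assoc, smul_smul, smul_smul, smul_smul, ← add_smul]
  congr 1
  have hu := mul_inv_cancel₀ (pow_ne_zero (C.card - 1) hw)
  generalize ((-q)⁻¹ ^ (C.card - 1))⁻¹ = u at hu ⊢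
  generalize (if i < j then (-q)⁻¹ ^ 2 else 1) = t
  linear_combination -((1 - q ^ 2 * t) *
    (-q)⁻¹ ^ ((I.filter (i < ·)).card + ((I.erase i).filter (· < j)).card)) * hu

theorem commute_minor_of_subset {q : k} (hq0 : q ≠ 0) {X : Matrix (Fin n) (Fin n) A}
    (hX : IsQGeneric q X) {I C J B : Finset (Fin n)} (hIC : I.card = C.card) (hJ : J ⊆ I)
    (hB : B ⊆ C) : Commute (minor q X J B) (minor q X I C) := by
  have key : ∀ cs : List (Fin n), (∀ c ∈ cs, c ∈ C) → ∀ S ⊆ I,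
      Commute (colExp q X cs S) (minor q X I C) := by
    intro cs
    induction cs with
    | nil =>
      intro _ S _
      rw [colExp]
      split_ifs
      exacts [Commute.one_left _, Commute.zero_left _]
    | cons c cs ih =>
      intro hcs S hS
      rw [colExp_cons]
      refine Commute.sum_left _ _ _ fun i hi => Commute.smul_left (Commute.mul_left ?_ ?_) _
      · exact entry_commute_minor hq0 hX hIC (hS hi) (hcs c (by simp))
      · exact ih (fun d hd => hcs d (by simp [hd])) _ ((Finset.erase_subset _ _).trans hS)
  exact key _ (fun c hc => hB (by simpa using hc)) J hJ

/-- If an entry of row `j` can be moved past `D` up to multiples of entries in the other rows of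
`J`, then a `q`-commutation relation with `D` passes from the minors with row set `J - j` to those
with row set `J`: in the Laplace expansion along row `j` the error terms have a repeated row. -/
theorem minor_mul_eq_smul_of_erase {q : k} (hq0 : q ≠ 0) {X : Matrix (Fin n) (Fin n) A}
    (hX : IsQGeneric q X) {I J B : Finset (Fin n)} {j : Fin n} (hj : j ∈ J) {D : A} {a b : k}
    (h : ∀ c ∈ B, minor q X (J.erase j) (B.erase c) * D =
      a • (D * minor q X (J.erase j) (B.erase c)))
    {P : Fin n → A} (hP : ∀ i ∈ I, i ∉ J.erase j → P i = 0)
    (hD : ∀ c ∈ B, X j c * D = b • (D * X j c) + ∑ i ∈ I, P i * X i c) :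
    minor q X J B * D = (a * b) • (D * minor q X J B) := by
  have hw : (-q)⁻¹ ≠ 0 := inv_ne_zero (neg_ne_zero.2 hq0)
  have e := sum_entry_mul_minor hq0 hX j (J.erase j) B
  rw [if_neg (by simp), Finset.insert_erase hj] at e
  have e0 : ∑ i ∈ I, P i * ∑ c ∈ B, (-q)⁻¹ ^ (B.filter (· < c)).card •
      (X i c * minor q X (J.erase j) (B.erase c)) = 0 := by
    refine Finset.sum_eq_zero fun i hi => ?_
    by_cases hiJ : i ∈ J.erase j
    · rw [sum_entry_mul_minor hq0 hX, if_pos hiJ, mul_zero]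
    · rw [hP i hi hiJ, zero_mul]
  refine (IsUnit.mk0 _ (pow_ne_zero ((J.erase j).filter (· < j)).card hw)).smul_left_cancel.1 ?_
  rw [smul_comm _ (a * b), ← mul_smul_comm _ D, ← smul_mul_assoc _ (minor q X J B), ← e,
    ← add_zero ((a * b) • _), ← smul_zero a, ← e0]
  simp only [Finset.sum_mul, Finset.mul_sum, Finset.smul_sum]
  rw [Finset.sum_comm (s := I), ← Finset.sum_add_distrib]
  refine Finset.sum_congr rfl fun c hc => ?_
  rw [smul_mul_assoc, mul_assoc, h c hc, mul_smul_comm, ← mul_assoc, hD c hc, add_mul, smul_add,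
    smul_add, Finset.sum_mul, Finset.smul_sum, Finset.smul_sum]
  congr 1
  · simp only [smul_mul_assoc, mul_smul_comm, smul_smul, mul_assoc]
    congr 1
    ring
  · refine Finset.sum_congr rfl fun i _ => ?_
    rw [mul_smul_comm, mul_assoc, smul_comm]

/-- The `q`-commutation relation for minors with arbitrary column sets `B ⊆ C`, which is what the
induction on `|J \ I|` needs, as the Laplace expansion removes an arbitrary column. -/
theorem minor_mul_minor_of_surrounds {q : k} (hq0 : q ≠ 0) {X : Matrix (Fin n) (Fin n) A}
    (hX : IsQGeneric q X) {I C : Finset (Fin n)} (hIC : I.card = C.card)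
    {J J' J'' B : Finset (Fin n)} (hB : B ⊆ C) (disj : Disjoint J' J'')
    (split : J \ I = J' ∪ J'') (left : ∀ j ∈ J', ∀ i ∈ I \ J, j < i)
    (right : ∀ i ∈ I \ J, ∀ j ∈ J'', i < j) :
    minor q X J B * minor q X I C =
      q ^ ((J''.card : ℤ) - (J'.card : ℤ)) • (minor q X I C * minor q X J B) := by
  induction hm : (J \ I).card generalizing J J' J'' B with
  | zero =>
    rw [Finset.card_eq_zero] at hm
    rw [hm, eq_comm, Finset.union_eq_empty] at split
    obtain ⟨rfl, rfl⟩ := split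
    simpa using (commute_minor_of_subset hq0 hX hIC (Finset.sdiff_eq_empty_iff_subset.1 hm) hB).eq
  | succ m ih =>
    obtain ⟨j, hj⟩ := Finset.card_pos.1 (by omega : 0 < (J \ I).card)
    have hm' : (J.erase j \ I).card = m := by
      rw [Finset.erase_sdiff_comm, Finset.card_erase_of_mem hj, hm, Nat.add_sub_cancel]
    have hjJ := (Finset.mem_sdiff.1 hj).1
    have hjI := (Finset.mem_sdiff.1 hj).2
    have hIJ : I \ J.erase j = I \ J := by
      ext i
      simp only [Finset.mem_sdiff, Finset.mem_erase]
      grind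
    have hB' : ∀ c, B.erase c ⊆ C := fun c => (Finset.erase_subset _ _).trans hB
    have hj' := hj
    rw [split, Finset.mem_union] at hj'
    rcases hj' with hj' | hj'
    · have hj'' : j ∉ J'' := Finset.disjoint_left.1 disj hj'
      obtain ⟨P, hP, hD⟩ := exists_entry_mul_minor_eq_inv_smul hq0 hX hIC hjI
      rw [minor_mul_eq_smul_of_erase hq0 hX hjJ (fun c _ => ih (J' := J'.erase j) (J'' := J'')
        (hB' c) (disj.mono_left (Finset.erase_subset _ _))
        (by rw [Finset.erase_sdiff_comm, split, Finset.erase_union_distrib,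
          Finset.erase_eq_of_notMem hj''])
        (fun i hi => by rw [hIJ]; exact left i (Finset.mem_of_mem_erase hi))
        (by rwa [hIJ]) hm') (fun i hi hiJ => hP i hi fun hlt => ?_) fun c hc => hD c (hB hc)]
      · rw [← zpow_neg_one, ← zpow_add₀ hq0, ← Finset.card_erase_add_one hj']
        congr 2
        push_cast
        ring
      · exact (left j hj' i (by rw [← hIJ]; exact Finset.mem_sdiff.2 ⟨hi, hiJ⟩)).not_gt hlt
    · have hj'' : j ∉ J' := Finset.disjoint_right.1 disj hj'
      obtain ⟨P, hP, hD⟩ := exists_entry_mul_minor_eq_smul hq0 hX hIC hjI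
      rw [minor_mul_eq_smul_of_erase hq0 hX hjJ (fun c _ => ih (J' := J') (J'' := J''.erase j)
        (hB' c) (disj.mono_right (Finset.erase_subset _ _))
        (by rw [Finset.erase_sdiff_comm, split, Finset.erase_union_distrib,
          Finset.erase_eq_of_notMem hj''])
        (by rwa [hIJ])
        (fun i hi t ht => right i (hIJ ▸ hi) t (Finset.mem_of_mem_erase ht)) hm')
        (fun i hi hiJ => hP i hi ?_) fun c hc => hD c (hB hc)]
      · rw [← zpow_add_one₀ hq0, ← Finset.card_erase_add_one hj']
        congr 2
        push_cast
        ring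
      · exact right i (by rw [← hIJ]; exact Finset.mem_sdiff.2 ⟨hi, hiJ⟩) j hj'

end QCommute

/-! ### Quantum minors as sums over permutations -/

section Permutations

variable {k A : Type*} [Field k] [Ring A] [Algebra k A]

/-- The permutation of `Fin (d + 1)` sending `0` to `p` and inducing `e` on the remaining
elements, both complements being identified with `Fin d` in an order-preserving way. -/
def permCons {d : ℕ} (p : Fin (d + 1)) (e : Equiv.Perm (Fin d)) : Equiv.Perm (Fin (d + 1)) :=
  (finSuccEquiv' 0).trans (e.optionCongr.trans (finSuccEquiv' p).symm)

theorem permCons_zero {d : ℕ} (p : Fin (d + 1)) (e : Equiv.Perm (Fin d)) :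
    permCons p e 0 = p := by
  simp [permCons]

theorem permCons_succ {d : ℕ} (p : Fin (d + 1)) (e : Equiv.Perm (Fin d)) (i : Fin d) :
    permCons p e i.succ = p.succAbove (e i) := by
  rw [← Fin.succAbove_zero]
  simp only [permCons, Equiv.trans_apply, finSuccEquiv'_succAbove]
  simp

theorem permCons_bijective (d : ℕ) :
    Function.Bijective fun x : Fin (d + 1) × Equiv.Perm (Fin d) => permCons x.1 x.2 := by
  refine (Fintype.bijective_iff_injective_and_card _).2 ⟨?_, ?_⟩
  · rintro ⟨p, e⟩ ⟨p', e'⟩ h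
    have h0 := DFunLike.congr_fun h 0
    simp only [permCons_zero] at h0
    subst h0
    refine Prod.ext rfl (Equiv.ext fun i => ?_)
    have hi := DFunLike.congr_fun h i.succ
    simp only [permCons_succ] at hi
    exact Fin.succAbove_right_injective hi
  · simp [Fintype.card_perm, Nat.factorial_succ]

theorem card_filter_succAbove_lt {d : ℕ} (p : Fin (d + 1)) :
    (Finset.univ.filter fun i : Fin d => p.succAbove i < p).card = p := by
  have h : (Finset.univ.filter fun i : Fin d => p.succAbove i < p).map p.succAboveEmb =
      Finset.Iio p := by
    ext a
    simp only [Finset.mem_map, Finset.mem_filter, Finset.mem_univ, true_and, Finset.mem_Iio,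
      Fin.succAboveEmb_apply]
    constructor
    · rintro ⟨i, hi, rfl⟩
      exact hi
    · intro ha
      obtain ⟨i, rfl⟩ := Fin.exists_succAbove_eq ha.ne
      exact ⟨i, ha, rfl⟩
  rw [← Finset.card_map, h, Fin.card_Iio]

theorem permLength_eq_sum {d : ℕ} (σ : Equiv.Perm (Fin d)) :
    permLength σ = ∑ i, ∑ j, if i < j ∧ σ j < σ i then 1 else 0 := by
  rw [permLength, Finset.card_filter, ← Finset.univ_product_univ, Finset.sum_product]

theorem permLength_permCons {d : ℕ} (p : Fin (d + 1)) (e : Equiv.Perm (Fin d)) :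
    permLength (permCons p e) = p + permLength e := by
  simp only [permLength_eq_sum, Fin.sum_univ_succ, permCons_zero, permCons_succ, false_and, if_false, zero_add, Fin.succ_pos, true_and, Fin.not_lt_zero, Fin.succ_lt_succ_iff,
    Fin.succAbove_lt_succAbove_iff]
  congr 1
  rw [Equiv.sum_comp e fun i => if p.succAbove i < p then 1 else 0, ← Finset.card_filter,
    card_filter_succAbove_lt]

/-- Expansion of the quantum determinant along its first column. -/
theorem qDet_succ {d : ℕ} (q : k) (M : Matrix (Fin (d + 1)) (Fin (d + 1)) A) :
    qDet q M = ∑ p : Fin (d + 1), (-q)⁻¹ ^ (p : ℕ) • (M p 0 * qDet q (M.submatrix p.succAbove Fin.succ)) := by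
  rw [qDet, ← (permCons_bijective d).sum_comp (M := A), Fintype.sum_prod_type]
  refine Finset.sum_congr rfl fun p _ => ?_
  rw [qDet, Finset.mul_sum, Finset.smul_sum]
  refine Finset.sum_congr rfl fun e _ => ?_
  rw [List.ofFn_succ, List.prod_cons, permLength_permCons, mul_smul_comm, smul_smul]
  simp only [permCons_zero, permCons_succ, Matrix.submatrix_apply, zpow_neg, zpow_natCast,
    inv_pow, pow_add, mul_inv]

/-- The bridge between sums over permutations and iterated column expansions. -/
theorem qDet_submatrix {d n : ℕ} (q : k) (X : Matrix (Fin n) (Fin n) A) {r : Fin d → Fin n}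
    (hr : StrictMono r) (c : Fin d → Fin n) :
    qDet q (X.submatrix r c) = colExp q X (List.ofFn c) (Finset.univ.image r) := by
  induction d with
  | zero => simp [qDet, colExp, permLength]
  | succ d ih =>
    rw [qDet_succ, List.ofFn_succ, colExp_cons, Finset.sum_image hr.injective.injOn]
    refine Finset.sum_congr rfl fun p _ => ?_
    have h1 : ((Finset.univ.image r).filter (· < r p)).card = p := by
      rw [Finset.filter_image, Finset.card_image_of_injective _ hr.injective]
      simp only [hr.lt_iff_lt]
      rw [← Fin.card_Iio]
      congr 1
      ext a
      simp
    have h2 : (Finset.univ.image r).erase (r p) = Finset.univ.image (r ∘ p.succAbove) := by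
      ext a
      simp only [Finset.mem_erase, Finset.mem_image, Finset.mem_univ, true_and,
        Function.comp_apply]
      constructor
      · rintro ⟨ha, b, rfl⟩
        obtain ⟨i, rfl⟩ := Fin.exists_succAbove_eq (x := b) (y := p) fun hh => ha (hh ▸ rfl)
        exact ⟨i, rfl⟩
      · rintro ⟨i, rfl⟩
        exact ⟨fun hh => Fin.succAbove_ne p i (hr.injective hh), _, rfl⟩
    rw [h1, h2, ← ih (hr.comp (Fin.strictMono_succAbove p)) fun i => c i.succ]
    rfl

theorem qMinor_eq_minor {n : ℕ} (q : k) (X : Matrix (Fin n) (Fin n) A) (I : Finset (Fin n)) :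
    qMinor q X I =
      minor q X I (Finset.univ.image (Fin.castLE (card_finset_fin_le I))) := by
  have hc : StrictMono (Fin.castLE (card_finset_fin_le I)) := Fin.strictMono_castLE _
  have e : (Finset.univ.image (Fin.castLE (card_finset_fin_le I))).sort =
      List.ofFn (Fin.castLE (card_finset_fin_le I)) := by
    refine List.Perm.eq_of_pairwise' (r := (· ≤ ·)) (Finset.pairwise_sort _ _)
      (List.pairwise_ofFn.2 fun i j hij => (hc hij).le) ?_
    refine (List.perm_ext_iff_of_nodup (Finset.sort_nodup _ _)
      (List.nodup_ofFn.2 hc.injective)).2 fun a => ?_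
    simp [List.mem_ofFn]
  rw [qMinor, qDet_submatrix q X (I.orderEmbOfFin rfl).strictMono, minor, e]
  simp

end Permutations

theorem theorem1p2 {k : Type*} [Field k] [CharZero k] (q : k) (hq0 : q ≠ 0)
    (hq : ∀ m : ℕ, 0 < m → q ^ m ≠ 1)
    {A : Type*} [Ring A] [Algebra k A] {n : ℕ} (X : Matrix (Fin n) (Fin n) A)
    (hX : IsQGeneric q X) (I J J' J'' : Finset (Fin n)) (hJI : Surrounds J I J' J'') :
    qMinor q X J * qMinor q X I =
      q ^ ((J''.card : ℤ) - (J'.card : ℤ)) • (qMinor q X I * qMinor q X J) := by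
  rw [qMinor_eq_minor, qMinor_eq_minor]
  refine minor_mul_minor_of_surrounds hq0 hX ?_ ?_ hJI.disj hJI.split hJI.left hJI.right
  · rw [Finset.card_image_of_injective _ (Fin.castLE_injective _), Finset.card_fin]
  · intro a ha
    obtain ⟨i, -, rfl⟩ := Finset.mem_image.1 ha
    exact Finset.mem_image.2 ⟨Fin.castLE hJI.card_le i, Finset.mem_univ _, by ext; simp⟩
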